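/- For a real polynomial $p$ of degree $d$ (with the convention $\deg 0 = 0$), let $\mathscr{W}(p)\in\mathbb{R}[x]$ be the polynomial, of degree at most $d$, defined by $$\sum_{j\ge 0} p(j)\,x^j=\frac{\mathscr{W}(p)(x)}{(1-x)^{d+1}}.$$ A polynomial $h\in\mathbb{R}[x]$ of degree at most $s$ is called symmetric with center of symmetry $s/2$ if $x^s h(1/x)=h(x)$. If $\mathscr{W}(p)$ is symmetric with center of symmetry $s/2$ for some integer $0\le s\le d$, then the defect of $p$ is $\operatorname{defect}(p)=d-s$ (it does not depend on the choice of $s$). A symmetric polynomial $h$ with center of symmetry $s/2$ can be written uniquely as $h(x)=\sum_{i=0}^{\lfloor s/2\rfloor}\gamma_i\,x^i(1+x)^{s-2i}$, and $h$ is called $\gamma$-positive if $\gamma_i\ge 0$ for all $i$. **Theorem.** Let $p,q\in\mathbb{R}[x]$ be polynomials such that $\mathscr{W}(p)$ and $\mathscr{W}(q)$ are symmetric, with centers of symmetry $s/2$ and $t/2$ for some integers $0\le s\le\deg p$ and $0\le t\le \deg q$, and such that $\operatorname{defect}(p)=\operatorname{defect}(q)$. Then $\mathscr{W}(pq)$ is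 symmetric, with center of symmetry $u/2$ for some integer $0\le u\le\deg (pq)$, and $\operatorname{defect}(pq)=\operatorname{defect}(p)=\operatorname{defect}(q)$. If, in addition, $\mathscr{W}(p)$ and $\mathscr{W}(q)$ are $\gamma$-positive, then $\mathscr{W}(pq)$ is $\gamma$-positive. -/

import Mathlib

open Polynomial

noncomputable section

namespace HadamardGamma

/-- The numerator polynomial `W p` of the generating function of `p`:
`∑_{j ≥ 0} p(j) x^j = W(p)(x) / (1 - x)^(deg p + 1)`.
It is the power series `(∑ p(j) x^j) (1 - x)^(deg p + 1)`, cut off above degree `deg p`;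
nothing is lost by the cut-off, see `coe_W`. -/
def W (p : ℝ[X]) : ℝ[X] :=
  PowerSeries.trunc (p.natDegree + 1)
    (PowerSeries.mk (fun j : ℕ => p.eval (j : ℝ)) * (1 - PowerSeries.X) ^ (p.natDegree + 1))

lemma coeff_mk_mul_one_sub_X_pow (f : ℝ → ℝ) (m n : ℕ) :
    PowerSeries.coeff (n + m)
      (PowerSeries.mk (fun j : ℕ => f (j : ℝ)) * (1 - PowerSeries.X) ^ m) =
      (fwdDiff (1 : ℝ))^[m] f (n : ℝ) := by
  induction m generalizing n with
  | zero => simp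
  | succ m ih =>
    have h1 := ih (n + 1)
    have h2 := ih n
    rw [pow_succ, ← mul_assoc, mul_sub, mul_one, map_sub, ← add_assoc,
      PowerSeries.coeff_succ_mul_X, h2, Function.iterate_succ_apply', fwdDiff]
    rw [show n + m + 1 = n + 1 + m by omega, h1]
    push_cast
    rfl

/-- The defining identity `∑_j p(j) x^j · (1 - x)^(deg p + 1) = W(p)`. -/
lemma coe_W (p : ℝ[X]) :
    ((W p : ℝ[X]) : PowerSeries ℝ) =
      PowerSeries.mk (fun j : ℕ => p.eval (j : ℝ)) * (1 - PowerSeries.X) ^ (p.natDegree + 1) := by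
  ext n
  rw [Polynomial.coeff_coe, W, PowerSeries.coeff_trunc]
  split_ifs with h
  · rfl
  · obtain ⟨k, rfl⟩ := Nat.exists_eq_add_of_le' (not_lt.mp h)
    rw [coeff_mk_mul_one_sub_X_pow (fun x => p.eval x)]
    have := congrFun (Polynomial.fwdDiff_iter_degree_add_one_eq_zero p) (k : ℝ)
    simpa using this.symm

/-- `h` has degree at most `s` and `x^s h(1/x) = h(x)`, that is, `h` is symmetric with center of
symmetry `s / 2`. -/
def IsSymmetricAt (h : ℝ[X]) (s : ℕ) : Prop :=
  h.natDegree ≤ s ∧ h.reflect s = h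

/-- `W p` is symmetric, with center of symmetry `s / 2` for some `s ≤ deg p`, and the defect
`deg p - s` of `p` is `c`. -/
def IsSymmetricWithDefect (p : ℝ[X]) (c : ℕ) : Prop :=
  ∃ s : ℕ, s ≤ p.natDegree ∧ IsSymmetricAt (W p) s ∧ p.natDegree - s = c

/-- `h` is symmetric, with center of symmetry `s / 2`, and the coefficients `γ i` in
`h = ∑_{0 ≤ i ≤ s/2} γ i * x^i * (1 + x)^(s - 2 i)` are nonnegative. -/
def IsGammaPositive (h : ℝ[X]) : Prop :=
  ∃ s : ℕ, IsSymmetricAt h s ∧ ∃ γ : ℕ → ℝ, (∀ i ≤ s / 2, 0 ≤ γ i) ∧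
    h = ∑ i ∈ Finset.range (s / 2 + 1), C (γ i) * (X ^ i * (1 + X) ^ (s - 2 * i))

lemma W_ne_zero {p : ℝ[X]} (hp : p ≠ 0) : W p ≠ 0 := by
  intro h
  have h1 := coe_W p
  rw [h, Polynomial.coe_zero, eq_comm, mul_eq_zero] at h1
  have h2 : (1 - PowerSeries.X : PowerSeries ℝ) ≠ 0 := by
    intro h3
    have := congrArg (PowerSeries.coeff 0) h3
    simp at this
  rcases h1 with h1 | h1
  · apply hp
    apply Polynomial.eq_zero_of_infinite_isRoot
    refine (Set.infinite_range_of_injective (Nat.cast_injective (R := ℝ))).mono ?_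
    rintro _ ⟨j, rfl⟩
    have := congrArg (PowerSeries.coeff j) h1
    simpa using this
  · exact pow_ne_zero _ h2 h1

lemma IsSymmetricAt.unique {h : ℝ[X]} (h0 : h ≠ 0) {s t : ℕ}
    (hs : IsSymmetricAt h s) (ht : IsSymmetricAt h t) : s = t := by
  have key : ∀ {s t : ℕ}, IsSymmetricAt h s → IsSymmetricAt h t → s ≤ t := by
    intro s t hs ht
    by_contra hlt
    have hd : h.coeff h.natDegree ≠ 0 := by simpa using h0
    have sym : ∀ {r : ℕ}, IsSymmetricAt h r → ∀ i ≤ r, h.coeff (r - i) = h.coeff i := by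
      intro r hr i hi
      rw [← revAt_le hi, ← coeff_reflect, hr.2]
    have e1 := sym ht h.natDegree ht.1
    have e2 := sym hs (t - h.natDegree) (by omega)
    have e3 := le_natDegree_of_ne_zero (p := h) (n := s - (t - h.natDegree))
      (by rw [e2, e1]; exact hd)
    have := ht.1
    omega
  exact le_antisymm (key hs ht) (key ht hs)

/-- The defect is well defined. -/
lemma IsSymmetricWithDefect.unique {p : ℝ[X]} {c c' : ℕ}
    (h : IsSymmetricWithDefect p c) (h' : IsSymmetricWithDefect p c') : c = c' := by
  obtain ⟨s, hs, hs', rfl⟩ := h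
  obtain ⟨t, ht, ht', rfl⟩ := h'
  by_cases hp : p = 0
  · simp [hp]
  · rw [hs'.unique (W_ne_zero hp) ht']

end HadamardGamma

end

/-! Multiplying `p` and `q` takes the coefficientwise (Hadamard) product of their value series. With
`deg p = s + c`, a symmetric `W p` expands in the `x^i (1+x)^(s-2i)`, so the value series of `p` is
a combination of `x^i (1+x)^b / (1-x)^(c+2i+b+1)` with `b = s - 2i`; the same `c` serves `q`. By
bilinearity both claims reduce to `gammaCone_hadamard`: two such basis series have a Hadamard
product whose numerator is γ-positive with center `(c+s+t)/2`. As `deg (pq) = s+t+2c`, the defect is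
again `c`.

Pulling out the smaller power of `x` leaves numerators `N(r,j,b,e)`. Raising `r` averages two
numerators of the same center, so `r = 0` suffices. There `1/(1-x)` is the Hadamard unit, which
gives `b = 0`, and one proves more: the differences `N(b+1,e) - (1+x) N(b,e)` are γ-positive too. In
the recurrences the negative term `-(1-x)^2` is then absorbed through `(1+x)^2 - (1-x)^2 = 4x`. -/

noncomputable section

namespace HadamardGamma

local notation "𝕏" => (PowerSeries.X : PowerSeries ℝ)

/-! ### Hadamard products and difference identities -/

/-- The power series `1 + x + x² + ⋯`, the inverse of `1 - x`. -/
def geom : PowerSeries ℝ := PowerSeries.mk fun _ => 1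

lemma geom_mul : geom * (1 - 𝕏) = 1 := PowerSeries.mk_one_mul_one_sub_eq_one ℝ

lemma geom_pow_mul (n : ℕ) : geom ^ n * (1 - 𝕏) ^ n = 1 := by
  rw [← mul_pow, geom_mul, one_pow]

/-- The Hadamard (coefficientwise) product of power series. -/
def hadamard (F G : PowerSeries ℝ) : PowerSeries ℝ :=
  PowerSeries.mk fun n => PowerSeries.coeff n F * PowerSeries.coeff n G

@[simp]
lemma coeff_hadamard (F G : PowerSeries ℝ) (n : ℕ) :
    PowerSeries.coeff n (hadamard F G) = PowerSeries.coeff n F * PowerSeries.coeff n G := by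
  simp [hadamard]

lemma hadamard_comm (F G : PowerSeries ℝ) : hadamard F G = hadamard G F := by
  ext n
  simp [mul_comm]

lemma hadamard_geom_left (F : PowerSeries ℝ) : hadamard geom F = F := by
  ext n
  simp [geom]

lemma hadamard_X_pow_mul (F G : PowerSeries ℝ) (i : ℕ) :
    hadamard (𝕏 ^ i * F) (𝕏 ^ i * G) = 𝕏 ^ i * hadamard F G := by
  ext n
  simp only [coeff_hadamard, PowerSeries.coeff_X_pow_mul']
  split_ifs <;> simp

lemma hadamard_sum_sum {ι κ : Type*} (s : Finset ι) (t : Finset κ) (a : ι → ℝ) (b : κ → ℝ)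
    (F : ι → PowerSeries ℝ) (G : κ → PowerSeries ℝ) :
    hadamard (∑ i ∈ s, PowerSeries.C (a i) * F i) (∑ k ∈ t, PowerSeries.C (b k) * G k) =
      ∑ i ∈ s, ∑ k ∈ t, PowerSeries.C (a i * b k) * hadamard (F i) (G k) := by
  ext n
  simp only [coeff_hadamard, map_sum, PowerSeries.coeff_C_mul, Finset.sum_mul_sum]
  exact Finset.sum_congr rfl fun i _ => Finset.sum_congr rfl fun k _ => by ring

/-- Leibniz rule for the backward difference. -/
lemma two_mul_one_sub_X_mul_hadamard (F G : PowerSeries ℝ) :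
    2 * ((1 - 𝕏) * hadamard F G) =
      hadamard ((1 - 𝕏) * F) ((1 + 𝕏) * G) + hadamard ((1 + 𝕏) * F) ((1 - 𝕏) * G) := by
  rw [two_mul]
  ext n
  cases n with
  | zero => simp [hadamard, add_mul, sub_mul]
  | succ n =>
    simp [add_mul, sub_mul, PowerSeries.coeff_succ_X_mul]
    ring

lemma coeff_succ_of_mul_eq {F G : PowerSeries ℝ} (h : (1 - 𝕏) * F = (1 + 𝕏) * G) (n : ℕ) :
    PowerSeries.coeff (n + 1) F = PowerSeries.coeff n F +
      PowerSeries.coeff (n + 1) G + PowerSeries.coeff n G := by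
  have := congrArg (PowerSeries.coeff (n + 1)) h
  simp [add_mul, sub_mul, PowerSeries.coeff_succ_X_mul] at this
  linarith

lemma coeff_zero_of_mul_eq {F G : PowerSeries ℝ} (h : (1 - 𝕏) * F = (1 + 𝕏) * G) :
    PowerSeries.coeff 0 F = PowerSeries.coeff 0 G := by
  have := congrArg (PowerSeries.coeff 0) h
  simpa [add_mul, sub_mul] using this

lemma one_sub_X_mul_hadamard {F F' G G' : PowerSeries ℝ} (hF : (1 - 𝕏) * F' = (1 + 𝕏) * F)
    (hG : (1 - 𝕏) * G' = (1 + 𝕏) * G) :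
    (1 - 𝕏) * hadamard F' G' =
      (1 + 𝕏) * (hadamard F G' + hadamard F' G) - (1 - 𝕏) * hadamard F G := by
  ext n
  cases n with
  | zero =>
    have h1 := coeff_zero_of_mul_eq hF
    have h2 := coeff_zero_of_mul_eq hG
    simp only [PowerSeries.coeff_zero_eq_constantCoeff] at h1 h2
    simp [hadamard, add_mul, sub_mul, h1, h2]
  | succ n =>
    simp only [add_mul, sub_mul, one_mul, map_add, map_sub, PowerSeries.coeff_succ_X_mul,
      coeff_hadamard, coeff_succ_of_mul_eq hF, coeff_succ_of_mul_eq hG]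
    ring

/-- `G` is the shifted second difference of `G'`, and each primed `F` has differences given by the
previous one; eliminating `G`, then `F''` and `F'`, leaves a coefficientwise ring identity. -/
lemma one_sub_X_sq_mul_hadamard {F F' F'' G G' : PowerSeries ℝ}
    (hF : (1 - 𝕏) * F' = (1 + 𝕏) * F) (hF' : (1 - 𝕏) * F'' = (1 + 𝕏) * F')
    (hG : (1 - 𝕏) ^ 2 * G' = 𝕏 * G) :
    (1 - 𝕏) ^ 2 * hadamard F'' G' - 2 * ((1 + 𝕏) * ((1 - 𝕏) * hadamard F' G')) +
      (1 + 𝕏) ^ 2 * hadamard F G' = 𝕏 * (hadamard F'' G - hadamard F G) := by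
  have e1 : ∀ A : PowerSeries ℝ, (1 - 𝕏) ^ 2 * A = A - 𝕏 * A - 𝕏 * A + 𝕏 * (𝕏 * A) := by
    intro A; ring
  have e2 : ∀ A : PowerSeries ℝ, (1 + 𝕏) ^ 2 * A = A + 𝕏 * A + 𝕏 * A + 𝕏 * (𝕏 * A) := by
    intro A; ring
  have e3 : ∀ A : PowerSeries ℝ, 2 * ((1 + 𝕏) * ((1 - 𝕏) * A)) =
      A - 𝕏 * (𝕏 * A) + (A - 𝕏 * (𝕏 * A)) := by
    intro A; ring
  rw [e1] at hG
  rw [e1, e2, e3]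
  have f0 := coeff_zero_of_mul_eq hF
  have f0' := coeff_zero_of_mul_eq hF'
  have g0 := congrArg (PowerSeries.coeff 0) hG
  have g1 := congrArg (PowerSeries.coeff 1) hG
  have f1 := coeff_succ_of_mul_eq hF 0
  have f1' := coeff_succ_of_mul_eq hF' 0
  ext n
  rcases n with _ | _ | n
  · simp [hadamard] at g0 f0 f0' ⊢
    simp [g0]
  · rw [zero_add] at *
    have x1 : ∀ A : PowerSeries ℝ, PowerSeries.coeff 1 (𝕏 * A) = PowerSeries.coeff 0 A :=
      fun A => PowerSeries.coeff_succ_X_mul 0 A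
    have x0 : ∀ A : PowerSeries ℝ, PowerSeries.coeff 0 (𝕏 * A) = 0 := by
      intro A; simp
    simp only [map_add, map_sub, x1, x0, coeff_hadamard] at g0 g1 ⊢
    rw [f1', f1, f0', f0, ← g1]
    have : PowerSeries.coeff 0 G' = 0 := by linarith
    rw [this]
    ring
  · have g2 := congrArg (PowerSeries.coeff (n + 1 + 1)) hG
    simp only [map_add, map_sub, PowerSeries.coeff_succ_X_mul, coeff_hadamard] at g2 ⊢
    rw [← g2]
    simp only [coeff_succ_of_mul_eq hF', coeff_succ_of_mul_eq hF]
    ring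

/-! ### Basis series and the γ-positive cone -/

/-- The series `(1 + x)^b / (1 - x)^(r + b + 1)`. -/
def baseSeries (r b : ℕ) : PowerSeries ℝ := (1 + 𝕏) ^ b * geom ^ (r + b + 1)

lemma baseSeries_zero_zero : baseSeries 0 0 = geom := by simp [baseSeries]

lemma one_sub_X_mul_baseSeries_succ (r b : ℕ) :
    (1 - 𝕏) * baseSeries (r + 1) b = baseSeries r b := by
  rw [baseSeries, baseSeries, show r + 1 + b + 1 = r + b + 1 + 1 by ring, pow_succ geom]
  linear_combination (1 + 𝕏) ^ b * geom ^ (r + b + 1) * geom_mul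

lemma one_add_X_mul_baseSeries_succ (r b : ℕ) :
    (1 + 𝕏) * baseSeries (r + 1) b = baseSeries r (b + 1) := by
  rw [baseSeries, baseSeries, show r + 1 + b + 1 = r + (b + 1) + 1 by ring]
  ring

lemma one_sub_X_mul_baseSeries (r b : ℕ) :
    (1 - 𝕏) * baseSeries r (b + 1) = (1 + 𝕏) * baseSeries r b := by
  rw [← one_add_X_mul_baseSeries_succ, ← one_sub_X_mul_baseSeries_succ r b]
  ring

/-- Nonnegative combinations of the polynomials `x^i (1 + x)^j` with `2 i + j = s`. -/
inductive GammaCone : ℕ → PowerSeries ℝ → Prop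
  | zero (s : ℕ) : GammaCone s 0
  | add {s : ℕ} {F G : PowerSeries ℝ} : GammaCone s F → GammaCone s G → GammaCone s (F + G)
  | monomial {a : ℝ} (ha : 0 ≤ a) {s i j : ℕ} (h : 2 * i + j = s) :
      GammaCone s (PowerSeries.C a * (𝕏 ^ i * (1 + 𝕏) ^ j))

namespace GammaCone

lemma X_pow_mul_one_add_X_pow {s i j : ℕ} (h : 2 * i + j = s) :
    GammaCone s (𝕏 ^ i * (1 + 𝕏) ^ j) := by
  simpa using GammaCone.monomial zero_le_one h

lemma const_mul {s : ℕ} {F : PowerSeries ℝ} (hF : GammaCone s F) {a : ℝ} (ha : 0 ≤ a) :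
    GammaCone s (PowerSeries.C a * F) := by
  induction hF with
  | zero s => simpa using GammaCone.zero s
  | add _ _ h1 h2 => rw [mul_add]; exact h1.add h2
  | monomial hb h =>
    rw [← mul_assoc, ← map_mul]
    exact GammaCone.monomial (mul_nonneg ha hb) h

lemma X_pow_mul {s : ℕ} {F : PowerSeries ℝ} (hF : GammaCone s F) (k : ℕ) {t : ℕ}
    (ht : s + 2 * k = t) : GammaCone t (𝕏 ^ k * F) := by
  induction hF with
  | zero s => simpa using GammaCone.zero _
  | add _ _ h1 h2 => rw [mul_add]; exact (h1 ht).add (h2 ht)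
  | @monomial a hb s i j h =>
    rw [show 𝕏 ^ k * (PowerSeries.C a * (𝕏 ^ i * (1 + 𝕏) ^ j)) =
      PowerSeries.C a * (𝕏 ^ (k + i) * (1 + 𝕏) ^ j) by ring]
    exact GammaCone.monomial hb (by omega)

lemma X_mul {s : ℕ} {F : PowerSeries ℝ} (hF : GammaCone s F) {t : ℕ}
    (ht : s + 2 = t) : GammaCone t (𝕏 * F) := by
  simpa using hF.X_pow_mul 1 (by omega)

lemma one_add_X_mul {s : ℕ} {F : PowerSeries ℝ} (hF : GammaCone s F) {t : ℕ}
    (ht : s + 1 = t) : GammaCone t ((1 + 𝕏) * F) := by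
  induction hF with
  | zero s => simpa using GammaCone.zero _
  | add _ _ h1 h2 => rw [mul_add]; exact (h1 ht).add (h2 ht)
  | @monomial a hb s i j h =>
    rw [show (1 + 𝕏) * (PowerSeries.C a * (𝕏 ^ i * (1 + 𝕏) ^ j)) =
      PowerSeries.C a * (𝕏 ^ i * (1 + 𝕏) ^ (j + 1)) by ring]
    exact GammaCone.monomial hb (by omega)

lemma sum {ι : Type*} {s : ℕ} (t : Finset ι) {F : ι → PowerSeries ℝ}
    (h : ∀ i ∈ t, GammaCone s (F i)) : GammaCone s (∑ i ∈ t, F i) :=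
  Finset.sum_induction F (GammaCone s) (fun _ _ => GammaCone.add) (GammaCone.zero s) h

lemma exists_eq_sum {s : ℕ} {F : PowerSeries ℝ} (hF : GammaCone s F) :
    ∃ γ : ℕ → ℝ, (∀ i, 0 ≤ γ i) ∧
      F = ∑ i ∈ Finset.range (s / 2 + 1), PowerSeries.C (γ i) * (𝕏 ^ i * (1 + 𝕏) ^ (s - 2 * i)) := by
  induction hF with
  | zero s => exact ⟨0, fun _ => le_rfl, by simp⟩
  | add _ _ h1 h2 =>
    obtain ⟨γ, h, rfl⟩ := h1
    obtain ⟨δ, h', rfl⟩ := h2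
    refine ⟨γ + δ, fun i => add_nonneg (h i) (h' i), ?_⟩
    simp [add_mul, Finset.sum_add_distrib]
  | @monomial a hb s i j h =>
    refine ⟨fun k => if k = i then a else 0, fun k => by dsimp only; split_ifs <;> simp [hb], ?_⟩
    rw [Finset.sum_eq_single_of_mem i (Finset.mem_range.2 (by omega))]
    · dsimp only
      rw [if_pos rfl, show s - 2 * i = j by omega]
    · intro k _ hk
      simp [hk]

end GammaCone

/-! ### Recurrences for the numerators -/

/-- The numerator of the Hadamard product of `(1 + x)^b / (1 - x)^(r + b + 1)` and
`x^j (1 + x)^e / (1 - x)^(r + 2 j + e + 1)`. -/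
def hadamardNumerator (r j b e : ℕ) : PowerSeries ℝ :=
  hadamard (baseSeries r b) (𝕏 ^ j * baseSeries (r + 2 * j) e) *
    (1 - 𝕏) ^ (2 * r + 2 * j + b + e + 1)

lemma two_mul_hadamardNumerator_succ (r j b e : ℕ) :
    2 * hadamardNumerator (r + 1) j b e =
      hadamardNumerator r j b (e + 1) + hadamardNumerator r j (b + 1) e := by
  have h := two_mul_one_sub_X_mul_hadamard (baseSeries (r + 1) b)
    (𝕏 ^ j * baseSeries (r + 2 * j + 1) e)
  rw [mul_left_comm (1 + 𝕏) (𝕏 ^ j), mul_left_comm (1 - 𝕏) (𝕏 ^ j),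
    one_sub_X_mul_baseSeries_succ, one_sub_X_mul_baseSeries_succ,
    one_add_X_mul_baseSeries_succ, one_add_X_mul_baseSeries_succ] at h
  simp only [hadamardNumerator]
  rw [show r + 1 + 2 * j = r + 2 * j + 1 by ring]
  linear_combination (1 - 𝕏) ^ (2 * r + 2 * j + b + e + 2) * h

lemma hadamardNumerator_succ_succ (r j b e : ℕ) :
    hadamardNumerator r j (b + 1) (e + 1) =
      (1 + 𝕏) * (hadamardNumerator r j b (e + 1) + hadamardNumerator r j (b + 1) e) -
        (1 - 𝕏) ^ 2 * hadamardNumerator r j b e := by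
  have h := one_sub_X_mul_hadamard (one_sub_X_mul_baseSeries r b)
    (G := 𝕏 ^ j * baseSeries (r + 2 * j) e) (G' := 𝕏 ^ j * baseSeries (r + 2 * j) (e + 1))
    (by rw [mul_left_comm, one_sub_X_mul_baseSeries]; ring)
  simp only [hadamardNumerator]
  linear_combination (1 - 𝕏) ^ (2 * r + 2 * j + b + e + 2) * h

lemma hadamardNumerator_zero_zero (j e : ℕ) :
    hadamardNumerator 0 j 0 e = 𝕏 ^ j * (1 + 𝕏) ^ e := by
  rw [hadamardNumerator, baseSeries_zero_zero, hadamard_geom_left, baseSeries]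
  rw [show 2 * 0 + 2 * j + 0 + e + 1 = 0 + 2 * j + e + 1 by ring]
  linear_combination (𝕏 ^ j * (1 + 𝕏) ^ e) * geom_pow_mul (0 + 2 * j + e + 1)

lemma hadamardNumerator_zero_zero_right (b : ℕ) :
    hadamardNumerator 0 0 b 0 = (1 + 𝕏) ^ b := by
  rw [hadamardNumerator, mul_zero, pow_zero, one_mul, add_zero, baseSeries_zero_zero,
    hadamard_comm, hadamard_geom_left, baseSeries]
  rw [show 2 * 0 + 0 + b + 0 + 1 = 0 + b + 1 by ring]
  linear_combination ((1 + 𝕏) ^ b) * geom_pow_mul (0 + b + 1)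

lemma one_sub_X_sq_mul_baseSeries (j : ℕ) :
    (1 - 𝕏) ^ 2 * (𝕏 ^ (j + 1) * baseSeries (0 + 2 * (j + 1)) 0) =
      𝕏 * (𝕏 ^ j * baseSeries (0 + 2 * j) 0) := by
  rw [← one_sub_X_mul_baseSeries_succ (0 + 2 * j), ← one_sub_X_mul_baseSeries_succ (0 + 2 * j + 1)]
  rw [show 0 + 2 * (j + 1) = 0 + 2 * j + 1 + 1 by ring]
  ring

/-- On the boundary `e = 0` this trades `j + 1` for `j`, at the price of second order in `b`. -/
lemma hadamardNumerator_recurrence (j b : ℕ) :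
    hadamardNumerator 0 (j + 1) (b + 2) 0 - 2 * (1 + 𝕏) * hadamardNumerator 0 (j + 1) (b + 1) 0 +
      (1 + 𝕏) ^ 2 * hadamardNumerator 0 (j + 1) b 0 =
    𝕏 * (hadamardNumerator 0 j (b + 2) 0 - (1 - 𝕏) ^ 2 * hadamardNumerator 0 j b 0) := by
  have h := one_sub_X_sq_mul_hadamard (one_sub_X_mul_baseSeries 0 b)
    (one_sub_X_mul_baseSeries 0 (b + 1)) (one_sub_X_sq_mul_baseSeries j)
  simp only [hadamardNumerator]
  linear_combination (1 - 𝕏) ^ (2 * j + b + 3) * h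

lemma coeff_baseSeries_zero_one (n : ℕ) :
    PowerSeries.coeff n (baseSeries 0 1) = 2 * n + 1 := by
  have h := one_sub_X_mul_baseSeries 0 0
  rw [baseSeries_zero_zero] at h
  induction n with
  | zero => rw [coeff_zero_of_mul_eq h]; simp [geom]
  | succ n ih =>
    rw [coeff_succ_of_mul_eq h, ih]
    simp [geom]
    ring

/-- Initial value at `b = 1`, which the second-order recurrence does not supply; it uses the
explicit coefficients `2n + 1` of `(1+x)/(1-x)^2`. -/
lemma hadamardNumerator_one (j : ℕ) :
    hadamardNumerator 0 (j + 1) 1 0 =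
      2 * (1 + 𝕏) * hadamardNumerator 0 (j + 1) 0 0 + 𝕏 * hadamardNumerator 0 j 1 0 := by
  have hG := one_sub_X_sq_mul_baseSeries j
  have key : ∀ G G' : PowerSeries ℝ, (1 - 𝕏) ^ 2 * G' = 𝕏 * G →
      (1 - 𝕏) ^ 2 * hadamard (baseSeries 0 1) G' =
        2 * ((1 + 𝕏) * ((1 - 𝕏) * hadamard (baseSeries 0 0) G')) +
          𝕏 * hadamard (baseSeries 0 1) G := by
    intro G G' hG
    have e1 : ∀ A : PowerSeries ℝ, (1 - 𝕏) ^ 2 * A = A - 𝕏 * A - 𝕏 * A + 𝕏 * (𝕏 * A) := by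
      intro A; ring
    have e3 : ∀ A : PowerSeries ℝ, 2 * ((1 + 𝕏) * ((1 - 𝕏) * A)) =
        A - 𝕏 * (𝕏 * A) + (A - 𝕏 * (𝕏 * A)) := by
      intro A; ring
    rw [e1] at hG
    rw [e1, e3, baseSeries_zero_zero, hadamard_geom_left]
    have x0 : ∀ A : PowerSeries ℝ, PowerSeries.coeff 0 (𝕏 * A) = 0 := by
      intro A; simp
    have g0 := congrArg (PowerSeries.coeff 0) hG
    simp only [map_add, map_sub, x0] at g0
    have g0' : PowerSeries.coeff 0 G' = 0 := by linarith
    ext n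
    have g := congrArg (PowerSeries.coeff n) hG
    rcases n with _ | _ | n
    · simp only [map_add, map_sub, x0, coeff_hadamard, g0']
      ring
    · simp only [map_add, map_sub, PowerSeries.coeff_succ_X_mul, x0, coeff_hadamard, g0',
        coeff_baseSeries_zero_one] at g ⊢
      rw [← g]
      push_cast
      ring
    · simp only [map_add, map_sub, PowerSeries.coeff_succ_X_mul, coeff_hadamard,
        coeff_baseSeries_zero_one] at g ⊢
      rw [← g]
      push_cast
      ring
  have h := key _ _ hG
  simp only [hadamardNumerator]
  linear_combination (1 - 𝕏) ^ (2 * j + 2) * h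

lemma C_four_mul (F : PowerSeries ℝ) : PowerSeries.C (4 : ℝ) * F = 4 * F := by
  rw [map_ofNat]

/-! ### Positivity of the numerators -/

/-- The second claim is the strengthening that makes the induction on `j` close; it yields the first
by induction on `b`. -/
lemma gammaCone_boundary (j : ℕ) :
    (∀ b, GammaCone (2 * j + b) (hadamardNumerator 0 j b 0)) ∧
      ∀ b, GammaCone (2 * j + b + 1)
        (hadamardNumerator 0 j (b + 1) 0 - (1 + 𝕏) * hadamardNumerator 0 j b 0) := by
  induction j with
  | zero =>
    simp only [hadamardNumerator_zero_zero_right]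
    refine ⟨fun b => ?_, fun b => ?_⟩
    · simpa using GammaCone.X_pow_mul_one_add_X_pow (i := 0) (j := b) rfl
    · rw [pow_succ', sub_self]
      exact GammaCone.zero _
  | succ j ih =>
    obtain ⟨hN, hU⟩ := ih
    have hU' : ∀ b, GammaCone (2 * (j + 1) + b + 1)
        (hadamardNumerator 0 (j + 1) (b + 1) 0 -
          (1 + 𝕏) * hadamardNumerator 0 (j + 1) b 0) := by
      intro b
      induction b with
      | zero =>
        have e : hadamardNumerator 0 (j + 1) (0 + 1) 0 -
            (1 + 𝕏) * hadamardNumerator 0 (j + 1) 0 0 =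
            𝕏 ^ (j + 1) * (1 + 𝕏) ^ 1 + 𝕏 * hadamardNumerator 0 j 1 0 := by
          rw [zero_add, hadamardNumerator_one, hadamardNumerator_zero_zero]
          ring
        rw [e]
        exact (GammaCone.X_pow_mul_one_add_X_pow (by omega)).add ((hN 1).X_mul (by omega))
      | succ b ih =>
        -- The recurrence rewritten in differences; `4 = ((1+x)^2 - (1-x)^2)/x`.
        have e : hadamardNumerator 0 (j + 1) (b + 1 + 1) 0 -
            (1 + 𝕏) * hadamardNumerator 0 (j + 1) (b + 1) 0 =
            (1 + 𝕏) * (hadamardNumerator 0 (j + 1) (b + 1) 0 -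
              (1 + 𝕏) * hadamardNumerator 0 (j + 1) b 0) +
            (𝕏 * (hadamardNumerator 0 j (b + 1 + 1) 0 -
                (1 + 𝕏) * hadamardNumerator 0 j (b + 1) 0) +
              (𝕏 * ((1 + 𝕏) * (hadamardNumerator 0 j (b + 1) 0 -
                (1 + 𝕏) * hadamardNumerator 0 j b 0)) +
              𝕏 ^ 2 * (PowerSeries.C 4 * hadamardNumerator 0 j b 0))) := by
          rw [C_four_mul]
          linear_combination hadamardNumerator_recurrence j b
        rw [e]
        exact (ih.one_add_X_mul (by omega)).add (((hU (b + 1)).X_mul (by omega)).add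
          ((((hU b).one_add_X_mul rfl).X_mul (by omega)).add
            (((hN b).const_mul (by norm_num)).X_pow_mul 2 (by omega))))
    refine ⟨fun b => ?_, hU'⟩
    induction b with
    | zero =>
      rw [hadamardNumerator_zero_zero]
      exact GammaCone.X_pow_mul_one_add_X_pow (by omega)
    | succ b ih =>
      rw [← sub_add_cancel (hadamardNumerator 0 (j + 1) (b + 1) 0)
        ((1 + 𝕏) * hadamardNumerator 0 (j + 1) b 0)]
      exact (hU' b).add (ih.one_add_X_mul rfl)

lemma gammaCone_hadamardNumerator_zero (j b e : ℕ) :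
    GammaCone (2 * j + b + e) (hadamardNumerator 0 j b e) := by
  induction b generalizing e with
  | zero =>
    rw [hadamardNumerator_zero_zero]
    exact GammaCone.X_pow_mul_one_add_X_pow (by omega)
  | succ b ihb =>
    have hU : GammaCone (2 * j + b + e + 1)
        (hadamardNumerator 0 j (b + 1) e - (1 + 𝕏) * hadamardNumerator 0 j b e) := by
      induction e with
      | zero => exact (gammaCone_boundary j).2 b
      | succ e ihe =>
        -- The terms in `N(b, e+1)` cancel, so the recurrence expresses each difference by the one
        -- at `e`.
        have e1 : hadamardNumerator 0 j (b + 1) (e + 1) -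
            (1 + 𝕏) * hadamardNumerator 0 j b (e + 1) =
            (1 + 𝕏) * (hadamardNumerator 0 j (b + 1) e -
              (1 + 𝕏) * hadamardNumerator 0 j b e) +
            𝕏 * (PowerSeries.C 4 * hadamardNumerator 0 j b e) := by
          rw [C_four_mul, hadamardNumerator_succ_succ]
          ring
        rw [e1]
        exact (ihe.one_add_X_mul (by omega)).add
          (((ihb e).const_mul (by norm_num)).X_mul (by omega))
    rw [← sub_add_cancel (hadamardNumerator 0 j (b + 1) e)
      ((1 + 𝕏) * hadamardNumerator 0 j b e)]
    rw [show 2 * j + (b + 1) + e = 2 * j + b + e + 1 by ring]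
    exact hU.add ((ihb e).one_add_X_mul rfl)

lemma gammaCone_hadamardNumerator (r j b e : ℕ) :
    GammaCone (r + 2 * j + b + e) (hadamardNumerator r j b e) := by
  induction r generalizing b e with
  | zero => simpa using gammaCone_hadamardNumerator_zero j b e
  | succ r ih =>
    have h : hadamardNumerator (r + 1) j b e = PowerSeries.C (1 / 2 : ℝ) *
        (hadamardNumerator r j b (e + 1) + hadamardNumerator r j (b + 1) e) := by
      rw [← two_mul_hadamardNumerator_succ, ← mul_assoc,
        show (2 : PowerSeries ℝ) = PowerSeries.C (2 : ℝ) by rw [map_ofNat], ← map_mul]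
      norm_num
    rw [h]
    refine GammaCone.const_mul (GammaCone.add ?_ ?_) (by norm_num)
    · convert ih b (e + 1) using 1; ring
    · convert ih (b + 1) e using 1; ring

/-- The Hadamard product of `x^i (1 + x)^b / (1 - x)^(c + 2 i + b + 1)` and
`x^k (1 + x)^e / (1 - x)^(c + 2 k + e + 1)` has a numerator with nonnegative `γ`-coefficients. -/
lemma gammaCone_hadamard (c i k b e : ℕ) :
    GammaCone (c + (2 * i + b) + (2 * k + e))
      (hadamard (𝕏 ^ i * baseSeries (c + 2 * i) b) (𝕏 ^ k * baseSeries (c + 2 * k) e) *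
        (1 - 𝕏) ^ ((c + 2 * i + b) + (c + 2 * k + e) + 1)) := by
  wlog h : i ≤ k generalizing i k b e
  · have := this k i e b (by omega)
    rw [hadamard_comm]
    convert this using 1
    · ring
    · congr 2; ring
  obtain ⟨j, rfl⟩ := Nat.exists_eq_add_of_le h
  have h1 := (gammaCone_hadamardNumerator (c + 2 * i) j b e).X_pow_mul i rfl
  rw [pow_add, mul_assoc (𝕏 ^ i) (𝕏 ^ j), hadamard_X_pow_mul, mul_assoc (𝕏 ^ i)]
  rw [hadamardNumerator] at h1
  convert h1 using 1
  · ring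
  · rw [show c + 2 * (i + j) = c + 2 * i + 2 * j by ring]
    congr 3
    ring

/-! ### Symmetric polynomials and their γ-expansions -/

lemma IsSymmetricAt.zero (s : ℕ) : IsSymmetricAt 0 s := by simp [IsSymmetricAt]

lemma IsSymmetricAt.add {h k : ℝ[X]} {s : ℕ} (hh : IsSymmetricAt h s) (hk : IsSymmetricAt k s) :
    IsSymmetricAt (h + k) s :=
  ⟨natDegree_add_le_of_degree_le hh.1 hk.1, by rw [reflect_add, hh.2, hk.2]⟩

lemma IsSymmetricAt.C_mul {h : ℝ[X]} {s : ℕ} (hh : IsSymmetricAt h s) (a : ℝ) :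
    IsSymmetricAt (C a * h) s :=
  ⟨(natDegree_C_mul_le a h).trans hh.1, by rw [reflect_C_mul, hh.2]⟩

lemma IsSymmetricAt.sum {ι : Type*} {s : ℕ} (t : Finset ι) {F : ι → ℝ[X]}
    (h : ∀ i ∈ t, IsSymmetricAt (F i) s) : IsSymmetricAt (∑ i ∈ t, F i) s :=
  Finset.sum_induction F (IsSymmetricAt · s) (fun _ _ => IsSymmetricAt.add)
    (IsSymmetricAt.zero s) h

lemma IsSymmetricAt.mul {h k : ℝ[X]} {s t : ℕ} (hh : IsSymmetricAt h s)
    (hk : IsSymmetricAt k t) : IsSymmetricAt (h * k) (s + t) :=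
  ⟨natDegree_mul_le_of_le hh.1 hk.1, by rw [reflect_mul h k hh.1 hk.1, hh.2, hk.2]⟩

lemma isSymmetricAt_X_pow (i : ℕ) : IsSymmetricAt (X ^ i) (2 * i) := by
  refine ⟨by simp [two_mul], ?_⟩
  rw [← one_mul (X ^ i), ← C_1, reflect_C_mul_X_pow, revAt_le (by omega)]
  congr 2
  omega

lemma isSymmetricAt_one_add_X_pow (j : ℕ) : IsSymmetricAt ((1 + X) ^ j) j := by
  induction j with
  | zero => exact ⟨by simp, by simp⟩
  | succ j ih =>
    rw [pow_succ]
    refine ih.mul ⟨?_, ?_⟩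
    · rw [add_comm, ← C_1, natDegree_X_add_C]
    · rw [reflect_add, reflect_one, ← pow_one (X : ℝ[X]), ← one_mul (X ^ 1), ← C_1,
        reflect_C_mul_X_pow]
      simp [revAt_le, add_comm]

lemma isSymmetricAt_gamma {s i : ℕ} (hi : i ≤ s / 2) :
    IsSymmetricAt (X ^ i * (1 + X) ^ (s - 2 * i)) s := by
  convert (isSymmetricAt_X_pow i).mul (isSymmetricAt_one_add_X_pow (s - 2 * i)) using 1
  omega

lemma IsSymmetricAt.coeff_sub {h : ℝ[X]} {s : ℕ} (hh : IsSymmetricAt h s) {i : ℕ} (hi : i ≤ s) :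
    h.coeff (s - i) = h.coeff i := by
  rw [← revAt_le hi, ← coeff_reflect, hh.2]

/-- A symmetric polynomial has an expansion in the polynomials `x^i (1 + x)^(s - 2 i)`. -/
lemma IsSymmetricAt.exists_gamma {h : ℝ[X]} {s : ℕ} (hh : IsSymmetricAt h s) :
    ∃ γ : ℕ → ℝ,
      h = ∑ i ∈ Finset.range (s / 2 + 1), C (γ i) * (X ^ i * (1 + X) ^ (s - 2 * i)) := by
  induction s using Nat.strong_induction_on generalizing h with
  | _ s ih =>
    -- Subtracting `h(0) (1+x)^s` kills the coefficients at `0` and, by symmetry, at `s`. The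
    -- remainder is `x` times a symmetric polynomial for `s - 2`, or zero if `s < 2`.
    set g := h + C (-h.coeff 0) * (1 + X) ^ s with hg
    have hgs : IsSymmetricAt g s := hh.add ((isSymmetricAt_one_add_X_pow s).C_mul _)
    have hg0 : g.coeff 0 = 0 := by
      simp [hg, coeff_zero_eq_eval_zero]
    have hgs0 : g.coeff s = 0 := by
      rw [← hgs.coeff_sub le_rfl, Nat.sub_self, hg0]
    have hdiv : X * g.divX = g := by
      have := X_mul_divX_add g
      rwa [hg0, C_0, add_zero] at this
    by_cases hs : s < 2
    · have : g = 0 := by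
        ext n
        rcases lt_or_ge s n with h1 | h1
        · rw [coeff_eq_zero_of_natDegree_lt (hgs.1.trans_lt h1), coeff_zero]
        · obtain rfl | rfl : n = 0 ∨ n = s := by omega
          · rw [hg0, coeff_zero]
          · rw [hgs0, coeff_zero]
      refine ⟨fun _ => h.coeff 0, ?_⟩
      rw [show s / 2 = 0 by omega]
      simp only [zero_add, Finset.range_one, Finset.sum_singleton, pow_zero, one_mul, mul_zero,
        Nat.sub_zero]
      rw [hg, C_neg] at this
      linear_combination this
    · obtain ⟨t, rfl⟩ := Nat.exists_eq_add_of_le' (not_lt.1 hs)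
      have hk : IsSymmetricAt g.divX t := by
        have hc : ∀ n, t < n → g.divX.coeff n = 0 := by
          intro n hn
          rw [coeff_divX]
          rcases Nat.lt_or_ge (t + 2) (n + 1) with h1 | h1
          · exact coeff_eq_zero_of_natDegree_lt (hgs.1.trans_lt h1)
          · rw [show n + 1 = t + 2 by omega, hgs0]
        have hd : g.divX.natDegree ≤ t := natDegree_le_iff_coeff_eq_zero.2 hc
        refine ⟨hd, ?_⟩
        ext n
        rw [coeff_reflect]
        rcases lt_or_ge t n with h1 | h1
        · rw [revAt_eq_self_of_lt h1]
        · rw [revAt_le h1, coeff_divX, coeff_divX, ← hgs.coeff_sub (show n + 1 ≤ t + 2 by omega)]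
          congr 1
          omega
      obtain ⟨γ, hγ⟩ := ih t (by omega) hk
      refine ⟨fun i => Nat.casesOn i (h.coeff 0) γ, ?_⟩
      rw [show (t + 2) / 2 + 1 = t / 2 + 1 + 1 by omega, Finset.sum_range_succ']
      have e : ∑ i ∈ Finset.range (t / 2 + 1),
          C (γ i) * (X ^ (i + 1) * (1 + X) ^ (t + 2 - 2 * (i + 1))) = X * g.divX := by
        rw [hγ, Finset.mul_sum]
        refine Finset.sum_congr rfl fun i _ => ?_
        rw [show t + 2 - 2 * (i + 1) = t - 2 * i by omega]
        ring
      simp only [e, hdiv]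
      simp [hg]

/-! ### From numerators to `W (p * q)` -/

lemma W_zero : W 0 = 0 := by
  have h : (PowerSeries.mk fun j : ℕ => (0 : ℝ[X]).eval (j : ℝ)) = 0 := by
    ext n
    simp
  rw [← Polynomial.coe_inj, coe_W, h, zero_mul, Polynomial.coe_zero]

lemma isGammaPositive_zero : IsGammaPositive 0 :=
  ⟨0, IsSymmetricAt.zero 0, 0, fun _ _ => le_rfl, by simp⟩

/-- The value series of `p` in terms of the `γ`-coefficients of `W p`. -/
lemma mk_eval_eq_sum {p : ℝ[X]} {s c : ℕ} (hd : p.natDegree = s + c) {γ : ℕ → ℝ}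
    (h : W p = ∑ i ∈ Finset.range (s / 2 + 1), C (γ i) * (X ^ i * (1 + X) ^ (s - 2 * i))) :
    PowerSeries.mk (fun j : ℕ => p.eval (j : ℝ)) =
      ∑ i ∈ Finset.range (s / 2 + 1),
        PowerSeries.C (γ i) * (𝕏 ^ i * baseSeries (c + 2 * i) (s - 2 * i)) := by
  have h1 : (W p : PowerSeries ℝ) * geom ^ (p.natDegree + 1) =
      PowerSeries.mk (fun j : ℕ => p.eval (j : ℝ)) := by
    rw [coe_W, mul_assoc, mul_comm (_ ^ _) (geom ^ _), geom_pow_mul, mul_one]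
  rw [← h1, h, ← Polynomial.coeToPowerSeries.ringHom_apply, map_sum, Finset.sum_mul]
  refine Finset.sum_congr rfl fun i hi => ?_
  have hi := Finset.mem_range.1 hi
  simp only [Polynomial.coeToPowerSeries.ringHom_apply, Polynomial.coe_mul, Polynomial.coe_C,
    Polynomial.coe_pow, Polynomial.coe_X, Polynomial.coe_add, Polynomial.coe_one, baseSeries]
  rw [show c + 2 * i + (s - 2 * i) + 1 = p.natDegree + 1 by omega]
  ring

/-- The polynomial whose `γ`-coefficients represent the Hadamard product of two basis series. -/
lemma exists_gamma_hadamard (c i k b e u : ℕ) (hu : c + (2 * i + b) + (2 * k + e) = u) :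
    ∃ g : ℝ[X], IsSymmetricAt g u ∧ GammaCone u (g : PowerSeries ℝ) ∧
      hadamard (𝕏 ^ i * baseSeries (c + 2 * i) b) (𝕏 ^ k * baseSeries (c + 2 * k) e) *
        (1 - 𝕏) ^ ((c + 2 * i + b) + (c + 2 * k + e) + 1) = (g : PowerSeries ℝ) := by
  subst hu
  have h := gammaCone_hadamard c i k b e
  obtain ⟨γ, -, hγ⟩ := h.exists_eq_sum
  refine ⟨∑ l ∈ Finset.range ((c + (2 * i + b) + (2 * k + e)) / 2 + 1),
    C (γ l) * (X ^ l * (1 + X) ^ (c + (2 * i + b) + (2 * k + e) - 2 * l)), ?_, ?_, ?_⟩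
  · refine IsSymmetricAt.sum _ fun l hl => IsSymmetricAt.C_mul (isSymmetricAt_gamma ?_) _
    exact Nat.lt_succ_iff.1 (Finset.mem_range.1 hl)
  all_goals
    have e1 : ((∑ l ∈ Finset.range ((c + (2 * i + b) + (2 * k + e)) / 2 + 1),
        C (γ l) * (X ^ l * (1 + X) ^ (c + (2 * i + b) + (2 * k + e) - 2 * l)) : ℝ[X]) :
        PowerSeries ℝ) = ∑ l ∈ Finset.range ((c + (2 * i + b) + (2 * k + e)) / 2 + 1),
        PowerSeries.C (γ l) * (𝕏 ^ l * (1 + 𝕏) ^ (c + (2 * i + b) + (2 * k + e) - 2 * l)) := by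
      rw [← Polynomial.coeToPowerSeries.ringHom_apply, map_sum]
      simp
  · rw [e1, ← hγ]
    exact h
  · rw [e1, ← hγ]

/-- `W (p * q)` as a combination of symmetric and `γ`-positive polynomials. -/
lemma exists_W_mul_eq_sum {p q : ℝ[X]} (hp : p ≠ 0) (hq : q ≠ 0) {s t c : ℕ}
    (hs : p.natDegree = s + c) (ht : q.natDegree = t + c) :
    ∃ g : ℕ → ℕ → ℝ[X], (∀ i ≤ s / 2, ∀ k ≤ t / 2, IsSymmetricAt (g i k) (c + s + t) ∧
        GammaCone (c + s + t) (g i k : PowerSeries ℝ)) ∧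
      ∀ γ δ : ℕ → ℝ,
        W p = ∑ i ∈ Finset.range (s / 2 + 1), C (γ i) * (X ^ i * (1 + X) ^ (s - 2 * i)) →
        W q = ∑ k ∈ Finset.range (t / 2 + 1), C (δ k) * (X ^ k * (1 + X) ^ (t - 2 * k)) →
        W (p * q) = ∑ i ∈ Finset.range (s / 2 + 1), ∑ k ∈ Finset.range (t / 2 + 1),
          C (γ i * δ k) * g i k := by
  have hex : ∀ i k, ∃ g : ℝ[X], i ≤ s / 2 → k ≤ t / 2 → IsSymmetricAt g (c + s + t) ∧
      GammaCone (c + s + t) (g : PowerSeries ℝ) ∧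
      hadamard (𝕏 ^ i * baseSeries (c + 2 * i) (s - 2 * i))
        (𝕏 ^ k * baseSeries (c + 2 * k) (t - 2 * k)) *
        (1 - 𝕏) ^ ((p * q).natDegree + 1) = (g : PowerSeries ℝ) := by
    intro i k
    by_cases h : i ≤ s / 2 ∧ k ≤ t / 2
    · obtain ⟨g, h1, h2, h3⟩ := exists_gamma_hadamard c i k (s - 2 * i) (t - 2 * k) (c + s + t)
        (by omega)
      refine ⟨g, fun _ _ => ⟨h1, h2, ?_⟩⟩
      rw [← h3, natDegree_mul hp hq]
      congr 2
      omega
    · exact ⟨0, fun h1 h2 => absurd ⟨h1, h2⟩ h⟩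
  choose g hg using hex
  refine ⟨g, fun i hi k hk => ⟨(hg i k hi hk).1, (hg i k hi hk).2.1⟩, fun γ δ hγ hδ => ?_⟩
  rw [← Polynomial.coe_inj, coe_W]
  have h1 : PowerSeries.mk (fun j : ℕ => (p * q).eval (j : ℝ)) =
      hadamard (PowerSeries.mk fun j : ℕ => p.eval (j : ℝ))
        (PowerSeries.mk fun j : ℕ => q.eval (j : ℝ)) := by
    ext n
    simp
  rw [h1, mk_eval_eq_sum hs hγ, mk_eval_eq_sum ht hδ, hadamard_sum_sum, Finset.sum_mul,
    ← Polynomial.coeToPowerSeries.ringHom_apply, map_sum]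
  refine Finset.sum_congr rfl fun i hi => ?_
  rw [Finset.sum_mul, map_sum]
  refine Finset.sum_congr rfl fun k hk => ?_
  rw [mul_assoc, (hg i k (Nat.lt_succ_iff.1 (Finset.mem_range.1 hi))
    (Nat.lt_succ_iff.1 (Finset.mem_range.1 hk))).2.2]
  simp only [Polynomial.coeToPowerSeries.ringHom_apply, Polynomial.coe_mul, Polynomial.coe_C]

lemma isGammaPositive_of_gammaCone {h : ℝ[X]} {s : ℕ} (hh : IsSymmetricAt h s)
    (hc : GammaCone s (h : PowerSeries ℝ)) : IsGammaPositive h := by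
  obtain ⟨γ, hγ, e⟩ := hc.exists_eq_sum
  refine ⟨s, hh, γ, fun i _ => hγ i, ?_⟩
  rw [← Polynomial.coe_inj, e, ← Polynomial.coeToPowerSeries.ringHom_apply, map_sum]
  simp

end HadamardGamma

end

theorem theorem1p3 (p q : ℝ[X]) (c : ℕ)
    (hp : HadamardGamma.IsSymmetricWithDefect p c)
    (hq : HadamardGamma.IsSymmetricWithDefect q c) :
    HadamardGamma.IsSymmetricWithDefect (p * q) c ∧
      (HadamardGamma.IsGammaPositive (HadamardGamma.W p) →
        HadamardGamma.IsGammaPositive (HadamardGamma.W q) →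
          HadamardGamma.IsGammaPositive (HadamardGamma.W (p * q))) := by
  open HadamardGamma in
  obtain ⟨s, hsd, hs, hsc⟩ := hp
  obtain ⟨t, htd, ht, htc⟩ := hq
  by_cases hpq : p * q = 0
  -- A zero factor has degree `0`, so its defect is `0`.
  · have hc : c = 0 := by
      rcases mul_eq_zero.1 hpq with h | h <;> subst h <;> simp at hsc htc <;> omega
    rw [hpq, W_zero]
    refine ⟨⟨0, by simp, ?_, by simp [hc]⟩, fun _ _ => isGammaPositive_zero⟩
    rw [W_zero]
    exact IsSymmetricAt.zero 0
  obtain ⟨hp0, hq0⟩ := mul_ne_zero_iff.1 hpq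
  obtain ⟨g, hg, hW⟩ := exists_W_mul_eq_sum hp0 hq0 (s := s) (t := t) (c := c)
    (by omega) (by omega)
  have hsym : IsSymmetricAt (W (p * q)) (c + s + t) := by
    obtain ⟨γ, hγ⟩ := hs.exists_gamma
    obtain ⟨δ, hδ⟩ := ht.exists_gamma
    rw [hW γ δ hγ hδ]
    exact IsSymmetricAt.sum _ fun i hi => IsSymmetricAt.sum _ fun k hk =>
      (hg i (Nat.lt_succ_iff.1 (Finset.mem_range.1 hi)) k
        (Nat.lt_succ_iff.1 (Finset.mem_range.1 hk))).1.C_mul _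
  refine ⟨⟨c + s + t, ?_, hsym, ?_⟩, fun hγp hγq => ?_⟩
  · rw [natDegree_mul hp0 hq0]; omega
  · rw [natDegree_mul hp0 hq0]; omega
  · obtain ⟨s', hs', γ, hγ, hγW⟩ := hγp
    obtain ⟨t', ht', δ, hδ, hδW⟩ := hγq
    -- γ-positivity brings its own center, which must agree with the one fixed by the defect.
    obtain rfl := hs.unique (W_ne_zero hp0) hs'
    obtain rfl := ht.unique (W_ne_zero hq0) ht'
    refine isGammaPositive_of_gammaCone hsym ?_
    rw [hW γ δ hγW hδW, ← Polynomial.coeToPowerSeries.ringHom_apply, map_sum]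
    refine GammaCone.sum _ fun i hi => ?_
    rw [map_sum]
    refine GammaCone.sum _ fun k hk => ?_
    have hi := Nat.lt_succ_iff.1 (Finset.mem_range.1 hi)
    have hk := Nat.lt_succ_iff.1 (Finset.mem_range.1 hk)
    rw [Polynomial.coeToPowerSeries.ringHom_apply, Polynomial.coe_mul, Polynomial.coe_C]
    exact (hg i hi k hk).2.const_mul (mul_nonneg (hγ i hi) (hδ k hk))
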